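/- Let $D$ and $T$ be disjoint finite sets (the states of Despot and of Tribune), $\Sigma$ a finite set of actions, and $\Delta\subseteq (T\times\Sigma\times D)\cup(D\times\Sigma\times T)$ a transition relation that is non-blocking: every $d\in D$ has some transition $(d,a,t)\in\Delta$ and every $t\in T$ some transition $(t,b,d)\in\Delta$. A strategy of Despot is a function $\sigma:(D\cdot\Sigma\cdot T\cdot\Sigma)^*\cdot D\to\Sigma$ such that the action $a=\sigma(h\,d)$ always has some transition $(d,a,\cdot)\in\Delta$; a strategy of Tribune is a function $\tau:(D\cdot\Sigma\cdot T\cdot\Sigma)^*\cdot D\cdot\Sigma\cdot T\to\Sigma$ such that the action $b=\tau(h\,d\,a\,t)$ always has some transition $(t,b,\cdot)\in\Delta$. A strategy is positional if its value depends only on the last state of its argument. For strategies $\sigma,\tau$ let $L(\sigma,\tau)$ be the set of all infinite words $d_0a_0t_0b_0d_1a_1t_1b_1\cdots$ (with any initial state $d_0\in D$) such that, for all $i\ge 0$, $(d_i,a_i,t_i)\in\Delta$, $(t_i,b_i,d_{i+1})\in\Delta$, $a_i=\sigma(d_0a_0t_0b_0\cdots t_{i-1}b_{i-1}d_i)$ and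 $b_i=\tau(d_0a_0t_0b_0\cdots d_ia_it_i)$. The payoff, which Despot minimizes and Tribune maximizes, is $$P(\sigma,\tau)=\limsup_{n\to\infty}\bigl|\mathrm{pref}_{4n}(L(\sigma,\tau))\bigr|^{1/n},$$ where $\mathrm{pref}_{4n}(L)$ is the set of prefixes of length $4n$ of the words in $L$. **Theorem.** Every such game (entropy game) is determined, and Despot and Tribune possess positional optimal strategies. That is, there is a real number $V\ge 0$ with $$\inf_\sigma\sup_\tau P(\sigma,\tau)=V=\sup_\tau\inf_\sigma P(\sigma,\tau),$$ where $\sigma$ and $\tau$ range over all strategies, and there are positional strategies $\sigma^*$ of Despot and $\tau^*$ of Tribune such that $P(\sigma^*,\tau)\le V$ for every strategy $\tau$ of Tribune and $P(\sigma,\tau^*)\ge V$ for every strategy $\sigma$ of Despot. -/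

import Mathlib

open Filter
open scoped ENNReal NNReal

namespace EntropyGame

/-- An arena with Despot's states `D`, Tribune's states `T` (disjoint, being separate types) and
actions `Act`. The transition relation, a subset of `T × Act × D ∪ D × Act × T`, is given by its two
parts. The arena is non-blocking: every state has at least one outgoing transition. -/
structure Arena (D T Act : Type*) where
  despotTrans : D → Act → T → Prop
  tribuneTrans : T → Act → D → Prop
  despot_nonblocking : ∀ d, ∃ a t, despotTrans d a t
  tribune_nonblocking : ∀ t, ∃ b d, tribuneTrans t b d

/-- One turn of the game: four consecutive letters `d a t b` of a play. -/
@[ext]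
structure Turn (D T Act : Type*) where
  despotState : D
  despotAction : Act
  tribuneState : T
  tribuneAction : Act

variable {D T Act : Type*}

/-- A strategy of Despot: a function from `(D · Act · T · Act)* · D` to `Act`, which always chooses
an action with a corresponding transition. -/
structure DespotStrategy (A : Arena D T Act) where
  act : List (Turn D T Act) → D → Act
  legal : ∀ h d, ∃ t, A.despotTrans d (act h d) t

/-- A strategy of Tribune: a function from `(D · Act · T · Act)* · D · Act · T` to `Act`, which
always chooses an action with a corresponding transition. -/
structure TribuneStrategy (A : Arena D T Act) where
  act : List (Turn D T Act) → D → Act → T → Act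
  legal : ∀ h d a t, ∃ d', A.tribuneTrans t (act h d a t) d'

/-- The choice of Despot depends only on the current state. -/
def DespotStrategy.IsPositional {A : Arena D T Act} (σ : DespotStrategy A) : Prop :=
  ∃ f : D → Act, ∀ h d, σ.act h d = f d

/-- The choice of Tribune depends only on the current state. -/
def TribuneStrategy.IsPositional {A : Arena D T Act} (τ : TribuneStrategy A) : Prop :=
  ∃ f : T → Act, ∀ h d a t, τ.act h d a t = f t

/-- The word formed by the first `n` turns (that is, the first `4 n` letters) of an infinite word. -/
def initialTurns (π : ℕ → Turn D T Act) (n : ℕ) : List (Turn D T Act) :=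
  (List.range n).map π

/-- An infinite word is a play if it respects the transition relation. -/
def Arena.IsPlay (A : Arena D T Act) (π : ℕ → Turn D T Act) : Prop :=
  ∀ n, A.despotTrans (π n).despotState (π n).despotAction (π n).tribuneState ∧
    A.tribuneTrans (π n).tribuneState (π n).tribuneAction (π (n + 1)).despotState

/-- All of Despot's actions in the word are those dictated by `σ`. -/
def DespotStrategy.Compatible {A : Arena D T Act} (σ : DespotStrategy A)
    (π : ℕ → Turn D T Act) : Prop :=
  ∀ n, (π n).despotAction = σ.act (initialTurns π n) (π n).despotState

/-- All of Tribune's actions in the word are those dictated by `τ`. -/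
def TribuneStrategy.Compatible {A : Arena D T Act} (τ : TribuneStrategy A)
    (π : ℕ → Turn D T Act) : Prop :=
  ∀ n, (π n).tribuneAction =
    τ.act (initialTurns π n) (π n).despotState (π n).despotAction (π n).tribuneState

/-- The `ω`-language of all infinite plays, from any initial state in `D`, compatible with both
strategies. -/
def playLanguage {A : Arena D T Act} (σ : DespotStrategy A) (τ : TribuneStrategy A) :
    Set (ℕ → Turn D T Act) :=
  {π | A.IsPlay π ∧ σ.Compatible π ∧ τ.Compatible π}

/-- The set of prefixes consisting of `n` turns (`4 n` letters) of the words of a language. -/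
def turnPrefixes (L : Set (ℕ → Turn D T Act)) (n : ℕ) : Set (List (Turn D T Act)) :=
  (fun π => initialTurns π n) '' L

/-- The amount that Despot pays to Tribune: the growth rate, with respect to the number of turns, of
the number of plays available to People. -/
noncomputable def payoff {A : Arena D T Act} (σ : DespotStrategy A) (τ : TribuneStrategy A) :
    ℝ≥0∞ :=
  limsup (fun n : ℕ => ((turnPrefixes (playLanguage σ τ) n).ncard : ℝ≥0∞) ^ (1 / (n : ℝ))) atTop

/-- The game is determined with value `V`: the least payoff that Despot can guarantee not to exceed
and the greatest payoff that Tribune can guarantee to reach, as infimum and supremum over all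
strategies, both equal `V`. -/
def Arena.IsDeterminedWithValue (A : Arena D T Act) (V : ℝ≥0∞) : Prop :=
  (⨅ σ : DespotStrategy A, ⨆ τ : TribuneStrategy A, payoff σ τ) = V ∧
    (⨆ τ : TribuneStrategy A, ⨅ σ : DespotStrategy A, payoff σ τ) = V

/-- With `σ`, Despot never pays more than `V`, against any strategy of Tribune. -/
def DespotStrategy.Guarantees {A : Arena D T Act} (σ : DespotStrategy A) (V : ℝ≥0∞) : Prop :=
  ∀ τ : TribuneStrategy A, payoff σ τ ≤ V

/-- With `τ`, Tribune never receives less than `V`, against any strategy of Despot. -/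
def TribuneStrategy.Guarantees {A : Arena D T Act} (τ : TribuneStrategy A) (V : ℝ≥0∞) : Prop :=
  ∀ σ : DespotStrategy A, V ≤ payoff σ τ

end EntropyGame

/-!
An action matters only through the set of states to which it lets People move. Let `F` be the
min-max operator which sends a weight `x` on Despot's states to the value of the one-turn game that
pays the total weight of the states reached, and let `V` be the greatest `l` such that `l • x ≤ F x`
for some nonzero `x ≥ 0`. If Tribune always maximizes for a vector `x` attaining `V`, then the
`x`-weighted number of plays grows at least by the factor `V` in each turn, whatever Despot does.
For `l > V`, homogeneity and compactness bound the nonnegative solutions of `l • x ≤ F x + 1`, and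
the one with the largest sum is a positive `u` with `F u ≤ l • u`; if Despot always minimizes for
`u`, the `u`-weighted number of plays grows at most by the factor `l`. Since there are only finitely
many ways to select successor sets, a single positional strategy of Despot works for all `l > V`.
-/

namespace EntropyGame

open Finset Topology

section NonlinearPerron

theorem nonneg_of_monotone_of_homogeneous {E : Type*} [AddCommMonoid E] [Module ℝ E] [Preorder E]
    {F : E → E} (hmono : Monotone F) (hhom : ∀ c : ℝ, 0 ≤ c → ∀ x, F (c • x) = c • F x) {x : E}
    (hx : 0 ≤ x) : 0 ≤ F x := by
  have hF0 : F 0 = 0 := by simpa only [zero_smul] using hhom 0 le_rfl 0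
  simpa only [hF0] using hmono hx

variable {ι : Type*} [Fintype ι] {F : (ι → ℝ) → ι → ℝ}

/-- The nonnegative lower Collatz–Wielandt numbers of `F`, the largest of which is the value of the
game when `F` is its one-turn operator. The vectors are normalized to lie in the simplex, which
excludes the vector `0`. -/
def collatzWielandt (F : (ι → ℝ) → ι → ℝ) : Set ℝ :=
  {l | 0 ≤ l ∧ ∃ x ∈ stdSimplex ℝ ι, l • x ≤ F x}

theorem isCompact_collatzWielandt (hcont : Continuous F) : IsCompact (collatzWielandt F) := by
  obtain ⟨C, hC⟩ := ((isCompact_stdSimplex ℝ ι).image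
    (f := fun x => ∑ i, F x i) (by fun_prop)).bddAbove
  have le_C {l : ℝ} {x : ι → ℝ} (hx : x ∈ stdSimplex ℝ ι) (hle : l • x ≤ F x) : l ≤ C :=
    calc l = ∑ i, l * x i := by rw [← mul_sum, hx.2, mul_one]
      _ ≤ ∑ i, F x i := sum_le_sum fun i _ => hle i
      _ ≤ C := hC ⟨x, hx, rfl⟩
  have hK : IsCompact ((Set.Icc 0 C ×ˢ stdSimplex ℝ ι) ∩ {p | p.1 • p.2 ≤ F p.2}) :=
    (isCompact_Icc.prod (isCompact_stdSimplex ℝ ι)).inter_right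
      (isClosed_le (by fun_prop) (by fun_prop))
  convert hK.image continuous_fst
  ext l
  constructor
  · rintro ⟨hl, x, hx, hle⟩
    exact ⟨(l, x), ⟨⟨⟨hl, le_C hx hle⟩, hx⟩, hle⟩, rfl⟩
  · rintro ⟨⟨l, x⟩, ⟨⟨⟨hl, -⟩, hx⟩, hle⟩, rfl⟩
    exact ⟨hl, x, hx, hle⟩

theorem exists_isGreatest_collatzWielandt [Nonempty ι] (hcont : Continuous F) (hmono : Monotone F)
    (hhom : ∀ c : ℝ, 0 ≤ c → ∀ x, F (c • x) = c • F x) :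
    ∃ V, IsGreatest (collatzWielandt F) V := by
  refine (isCompact_collatzWielandt hcont).exists_isGreatest ?_
  obtain ⟨x, hx⟩ : Nonempty (stdSimplex ℝ ι) := inferInstance
  have hFx : 0 ≤ F x := nonneg_of_monotone_of_homogeneous hmono hhom hx.1
  exact ⟨0, le_rfl, x, hx, by rwa [zero_smul]⟩

theorem exists_pos_forall_not_smul_le_add (hcont : Continuous F) {l : ℝ}
    (hl : ∀ x ∈ stdSimplex ℝ ι, ¬ l • x ≤ F x) :
    ∃ δ > 0, ∀ x ∈ stdSimplex ℝ ι, ¬ l • x ≤ F x + Function.const ι δ := by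
  have hclosed : IsClosed {p : ℝ × (ι → ℝ) | l • p.2 ≤ F p.2 + Function.const ι p.1} :=
    isClosed_le (by fun_prop) (by fun_prop)
  have hsmall : ∀ᶠ δ in 𝓝[>] (0 : ℝ), ∀ x ∈ stdSimplex ℝ ι,
      ¬ l • x ≤ F x + Function.const ι δ :=
    nhdsWithin_le_nhds <|
      (isCompact_stdSimplex ℝ ι).eventually_forall_of_forall_eventually fun x hx =>
        hclosed.isOpen_compl.mem_nhds (by simpa using hl x hx)
  exact (hsmall.and self_mem_nhdsWithin).exists.imp fun δ h => ⟨h.2, h.1⟩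

theorem isCompact_setOf_smul_le_add_one (hcont : Continuous F)
    (hhom : ∀ c : ℝ, 0 ≤ c → ∀ x, F (c • x) = c • F x) {l : ℝ}
    (hl : ∀ x ∈ stdSimplex ℝ ι, ¬ l • x ≤ F x) :
    IsCompact {x : ι → ℝ | 0 ≤ x ∧ l • x ≤ F x + 1} := by
  obtain ⟨δ, hδ, hgap⟩ := exists_pos_forall_not_smul_le_add hcont hl
  have hclosed : IsClosed {x : ι → ℝ | 0 ≤ x ∧ l • x ≤ F x + 1} :=
    (isClosed_le (by fun_prop) (by fun_prop)).and (isClosed_le (by fun_prop) (by fun_prop))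
  refine (isCompact_Icc (a := 0) (b := Function.const ι δ⁻¹)).of_isClosed_subset hclosed ?_
  rintro x ⟨hx, hle⟩
  have hmass : ∑ i, x i ≤ δ⁻¹ := by
    by_contra! hlarge
    set m := ∑ i, x i
    have hm : 0 < m := (inv_pos.2 hδ).trans hlarge
    refine hgap (m⁻¹ • x) ⟨fun i => mul_nonneg (inv_nonneg.2 hm.le) (hx i), ?_⟩ fun i => ?_
    · simp only [Pi.smul_apply, smul_eq_mul, ← mul_sum]
      exact inv_mul_cancel₀ hm.ne'
    · rw [hhom _ (inv_nonneg.2 hm.le)]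
      calc l * (m⁻¹ * x i) = m⁻¹ * (l * x i) := by ring
        _ ≤ m⁻¹ * (F x i + 1) := mul_le_mul_of_nonneg_left (hle i) (inv_nonneg.2 hm.le)
        _ = m⁻¹ * F x i + m⁻¹ := by ring
        _ ≤ m⁻¹ * F x i + δ := by gcongr; exact inv_le_of_inv_le₀ hδ hlarge.le
  exact ⟨hx, fun i => (single_le_sum (fun j _ => hx j) (mem_univ i)).trans hmass⟩

theorem exists_smul_eq_add_one (hcont : Continuous F) (hmono : Monotone F)
    (hhom : ∀ c : ℝ, 0 ≤ c → ∀ x, F (c • x) = c • F x) {l : ℝ} (hl : 0 < l)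
    (hl' : l ∉ collatzWielandt F) : ∃ u : ι → ℝ, 0 ≤ u ∧ l • u = F u + 1 := by
  have hF0 : 0 ≤ F 0 := nonneg_of_monotone_of_homogeneous hmono hhom le_rfl
  have hgap : ∀ x ∈ stdSimplex ℝ ι, ¬ l • x ≤ F x := fun x hx hle => hl' ⟨hl.le, x, hx, hle⟩
  have hne : {x : ι → ℝ | 0 ≤ x ∧ l • x ≤ F x + 1}.Nonempty :=
    ⟨0, le_rfl, by rw [smul_zero]; exact add_nonneg hF0 zero_le_one⟩
  obtain ⟨u, ⟨hu, hle⟩, hmax⟩ := (isCompact_setOf_smul_le_add_one hcont hhom hgap).exists_isMaxOn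
    hne (f := fun x => ∑ i, x i) (by fun_prop)
  -- `x ↦ l⁻¹ • (F x + 1)` is monotone, so it maps the set of its subsolutions into itself.
  let w : ι → ℝ := l⁻¹ • (F u + 1)
  have hlw : l • w = F u + 1 := smul_inv_smul₀ hl.ne' _
  have huw : u ≤ w := (le_inv_smul_iff_of_pos hl).2 hle
  have hsum : ∑ i, w i ≤ ∑ i, u i :=
    hmax ⟨hu.trans huw, hlw.trans_le (add_le_add_left (hmono huw) 1)⟩
  have hwu : u = w := funext fun i =>
    (sum_eq_sum_iff_of_le fun i _ => huw i).1 ((sum_le_sum fun i _ => huw i).antisymm hsum) i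
      (mem_univ i)
  exact ⟨u, hu, by rwa [← hwu] at hlw⟩

theorem exists_pos_le_smul (hcont : Continuous F) (hmono : Monotone F)
    (hhom : ∀ c : ℝ, 0 ≤ c → ∀ x, F (c • x) = c • F x) {l : ℝ} (hl : 0 < l)
    (hl' : l ∉ collatzWielandt F) : ∃ u : ι → ℝ, (∀ i, 0 < u i) ∧ F u ≤ l • u := by
  obtain ⟨u, hu, heq⟩ := exists_smul_eq_add_one hcont hmono hhom hl hl'
  have hFu : 0 ≤ F u := nonneg_of_monotone_of_homogeneous hmono hhom hu
  refine ⟨u, fun i => ?_, heq ▸ le_add_of_nonneg_right zero_le_one⟩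
  have hi : l * u i = F u i + 1 := congrFun heq i
  exact pos_of_mul_pos_right (hi ▸ add_pos_of_nonneg_of_pos (hFu i) one_pos) hl.le

end NonlinearPerron

section Options

variable {ι κ Act : Type*} [Fintype κ] {R : ι → Act → κ → Prop}

open Classical in
/-- The states to which People may move from `i` when the action `a` is played, for the half `R` of
a transition relation. -/
noncomputable def successors (R : ι → Act → κ → Prop) (i : ι) (a : Act) : Finset κ :=
  {k | R i a k}

open Classical in
/-- The nonempty successor sets among which a player can choose in state `i`. Actions with the same
successors being interchangeable, choices are made among these finitely many sets, even if there are
infinitely many actions. -/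
noncomputable def options (R : ι → Act → κ → Prop) (i : ι) : Finset (Finset κ) :=
  {S | S.Nonempty ∧ ∃ a, successors R i a = S}

@[simp]
theorem mem_successors {i : ι} {a : Act} {k : κ} : k ∈ successors R i a ↔ R i a k := by
  simp [successors]

@[simp]
theorem mem_options {i : ι} {S : Finset κ} :
    S ∈ options R i ↔ S.Nonempty ∧ ∃ a, successors R i a = S := by
  simp [options]

theorem successors_mem_options {i : ι} {a : Act} (h : ∃ k, R i a k) :
    successors R i a ∈ options R i :=
  mem_options.2 ⟨h.imp fun _ => mem_successors.2, a, rfl⟩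

theorem exists_action_of_mem_options {i : ι} {S : Finset κ} (hS : S ∈ options R i) :
    ∃ a, (∃ k, R i a k) ∧ successors R i a = S := by
  obtain ⟨hne, a, rfl⟩ := mem_options.1 hS
  exact ⟨a, hne.imp fun _ => mem_successors.1, rfl⟩

variable (hR : ∀ i, ∃ a k, R i a k)

include hR in
theorem options_nonempty (i : ι) : (options R i).Nonempty :=
  (hR i).imp' (successors R i) fun _ => successors_mem_options

/-- The least total weight of an option in state `i`. -/
noncomputable def minOption (x : κ → ℝ) (i : ι) : ℝ :=
  (options R i).inf' (options_nonempty hR i) fun S => ∑ k ∈ S, x k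

/-- The greatest total weight of an option in state `i`. -/
noncomputable def maxOption (x : κ → ℝ) (i : ι) : ℝ :=
  (options R i).sup' (options_nonempty hR i) fun S => ∑ k ∈ S, x k

theorem monotone_minOption : Monotone (minOption hR) := fun _ _ hxy _ =>
  inf'_mono_fun fun _ _ => sum_le_sum fun k _ => hxy k

theorem monotone_maxOption : Monotone (maxOption hR) := fun _ _ hxy _ =>
  sup'_mono_fun fun _ _ => sum_le_sum fun k _ => hxy k

theorem continuous_minOption : Continuous (minOption hR) :=
  continuous_pi fun _ => Continuous.finset_inf'_apply _ fun _ _ => by fun_prop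

theorem continuous_maxOption : Continuous (maxOption hR) :=
  continuous_pi fun _ => Continuous.finset_sup'_apply _ fun _ _ => by fun_prop

theorem minOption_smul {c : ℝ} (hc : 0 ≤ c) (x : κ → ℝ) :
    minOption hR (c • x) = c • minOption hR x := by
  ext i
  simp only [minOption, Pi.smul_apply, smul_eq_mul, ← mul_sum]
  exact (apply_inf'_eq_inf'_comp _ (c * ·) fun _ _ =>
    (monotone_mul_left_of_nonneg hc).map_min).symm

theorem maxOption_smul {c : ℝ} (hc : 0 ≤ c) (x : κ → ℝ) :
    maxOption hR (c • x) = c • maxOption hR x := by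
  ext i
  simp only [maxOption, Pi.smul_apply, smul_eq_mul, ← mul_sum, mul₀_sup' hc]

theorem minOption_le {x : κ → ℝ} {i : ι} {a : Act} (h : ∃ k, R i a k) :
    minOption hR x i ≤ ∑ k ∈ successors R i a, x k :=
  inf'_le _ (successors_mem_options h)

theorem le_maxOption {x : κ → ℝ} {i : ι} {a : Act} (h : ∃ k, R i a k) :
    ∑ k ∈ successors R i a, x k ≤ maxOption hR x i :=
  le_sup' (fun S => ∑ k ∈ S, x k) (successors_mem_options h)

theorem exists_option_eq_minOption (x : κ → ℝ) (i : ι) :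
    ∃ S ∈ options R i, ∑ k ∈ S, x k = minOption hR x i :=
  (exists_mem_eq_inf' (options_nonempty hR i) _).imp fun _ h => ⟨h.1, h.2.symm⟩

theorem exists_action_eq_maxOption (x : κ → ℝ) (i : ι) :
    ∃ a, (∃ k, R i a k) ∧ ∑ k ∈ successors R i a, x k = maxOption hR x i := by
  obtain ⟨S, hS, hmax⟩ := exists_mem_eq_sup' (options_nonempty hR i) fun S => ∑ k ∈ S, x k
  obtain ⟨a, ha, rfl⟩ := exists_action_of_mem_options hS
  exact ⟨a, ha, hmax.symm⟩

end Options

section TurnOperator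

variable {D T Act : Type*} [Fintype D] [Fintype T] (A : Arena D T Act)

/-- The one-turn operator of the game: `A.turnOperator x d` is the value of the game of a single
turn from `d` which pays the sum of the weights `x` of the states where People may end up. -/
noncomputable def Arena.turnOperator (x : D → ℝ) : D → ℝ :=
  minOption A.despot_nonblocking (maxOption A.tribune_nonblocking x)

theorem Arena.monotone_turnOperator : Monotone A.turnOperator :=
  (monotone_minOption _).comp (monotone_maxOption _)

theorem Arena.continuous_turnOperator : Continuous A.turnOperator :=
  (continuous_minOption _).comp (continuous_maxOption _)

theorem Arena.turnOperator_smul (c : ℝ) (hc : 0 ≤ c) (x : D → ℝ) :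
    A.turnOperator (c • x) = c • A.turnOperator x := by
  simp only [turnOperator, maxOption_smul _ hc, minOption_smul _ hc]

variable {A} in
/-- Finiteness of the set of selections makes one of them serve all `l > V`. -/
theorem Arena.exists_selection {V : ℝ} (hV : 0 ≤ V)
    (hub : V ∈ upperBounds (collatzWielandt A.turnOperator)) :
    ∃ s : D → Finset T, (∀ d, s d ∈ options A.despotTrans d) ∧ ∀ l > V, ∃ u : D → ℝ,
      (∀ d, 0 < u d) ∧ ∀ d, ∑ t ∈ s d, maxOption A.tribune_nonblocking u t ≤ l * u d := by
  have hsel (l : ℝ) (hl : V < l) : ∃ s : D → Finset T, (∀ d, s d ∈ options A.despotTrans d) ∧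
      ∃ u : D → ℝ, (∀ d, 0 < u d) ∧
        ∀ d, ∑ t ∈ s d, maxOption A.tribune_nonblocking u t ≤ l * u d := by
    obtain ⟨u, hu, hle⟩ := exists_pos_le_smul A.continuous_turnOperator A.monotone_turnOperator
      A.turnOperator_smul (hV.trans_lt hl) fun hmem => hl.not_ge (hub hmem)
    choose s hs hmin using
      exists_option_eq_minOption A.despot_nonblocking (maxOption A.tribune_nonblocking u)
    exact ⟨s, hs, u, hu, fun d => (hmin d).trans_le (hle d)⟩
  by_contra! hfail
  choose! bound hbound hnot using hfail
  obtain ⟨l, hVl, hl⟩ : ∃ l > V, ∀ s, (∀ d, s d ∈ options A.despotTrans d) → l < bound s := by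
    have hev : ∀ᶠ l in 𝓝[>] V, ∀ s, (∀ d, s d ∈ options A.despotTrans d) → l < bound s :=
      eventually_all.2 fun s => eventually_imp_distrib_left.2 fun hs =>
        nhdsWithin_le_nhds (eventually_lt_nhds (hbound s hs))
    exact (hev.and self_mem_nhdsWithin).exists.imp fun l h => ⟨h.2, h.1⟩
  obtain ⟨s, hs, u, hu, hle⟩ := hsel l hVl
  obtain ⟨d, hd⟩ := hnot s hs u hu
  exact hd.not_ge ((hle d).trans (mul_le_mul_of_nonneg_right (hl s hs).le (hu d).le))

end TurnOperator

section Positions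

variable {D T Act : Type*} {A : Arena D T Act}

theorem initialTurns_succ (π : ℕ → Turn D T Act) (n : ℕ) :
    initialTurns π (n + 1) = initialTurns π n ++ [π n] := by
  simp [initialTurns, List.range_succ]

/-- A position of the game in which Despot is to move: the history and the current state. -/
abbrev Position (D T Act : Type*) := List (Turn D T Act) × D

variable (σ : DespotStrategy A) (τ : TribuneStrategy A)

/-- The turn played in position `p` if People respond to Despot's action by moving to `t`. -/
def nextTurn (p : Position D T Act) (t : T) : Turn D T Act where
  despotState := p.2
  despotAction := σ.act p.1 p.2
  tribuneState := t
  tribuneAction := τ.act p.1 p.2 (σ.act p.1 p.2) t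

/-- The position reached from `p` when People move first to `m.1` and then to `m.2`. -/
def nextPosition (p : Position D T Act) (m : Σ _ : T, D) : Position D T Act :=
  (p.1 ++ [nextTurn σ τ p m.1], m.2)

theorem nextPosition_injective : Function.Injective
    fun q : Σ _ : Position D T Act, Σ _ : T, D => nextPosition σ τ q.1 q.2 := by
  rintro ⟨⟨w, d⟩, t, e⟩ ⟨⟨w', d'⟩, t', e'⟩ h
  obtain ⟨hhist, rfl⟩ := Prod.mk.inj h
  obtain ⟨rfl, hturn⟩ := List.append_inj' hhist rfl
  obtain ⟨rfl, -, rfl, -⟩ := Turn.mk.inj (List.singleton_inj.1 hturn)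
  rfl

variable [Fintype D] [Fintype T]

/-- The pairs of moves available to People during the turn played in position `p`. -/
noncomputable def moves (p : Position D T Act) : Finset (Σ _ : T, D) :=
  (successors A.despotTrans p.2 (σ.act p.1 p.2)).sigma fun t =>
    successors A.tribuneTrans t (τ.act p.1 p.2 (σ.act p.1 p.2) t)

open Classical in
/-- The positions that can be reached in `n` turns. -/
noncomputable def positions : ℕ → Finset (Position D T Act)
  | 0 => univ.image fun d => ([], d)
  | n + 1 => ((positions n).sigma (moves σ τ)).image fun q => nextPosition σ τ q.1 q.2

/-- An infinite sequence of positions as it arises in the course of a play. It may start at any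
position, not only at one with empty history. -/
def IsRun (s : ℕ → Position D T Act) : Prop :=
  ∀ k, ∃ m ∈ moves σ τ (s k), nextPosition σ τ (s k) m = s (k + 1)

variable {σ τ}

theorem mem_moves {p : Position D T Act} {m : Σ _ : T, D} :
    m ∈ moves σ τ p ↔ A.despotTrans p.2 (nextTurn σ τ p m.1).despotAction m.1 ∧
      A.tribuneTrans m.1 (nextTurn σ τ p m.1).tribuneAction m.2 := by
  simp [moves, nextTurn]

theorem moves_nonempty (p : Position D T Act) : (moves σ τ p).Nonempty := by
  obtain ⟨t, ht⟩ := σ.legal p.1 p.2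
  obtain ⟨d, hd⟩ := τ.legal p.1 p.2 (σ.act p.1 p.2) t
  exact ⟨⟨t, d⟩, mem_moves.2 ⟨ht, hd⟩⟩

theorem mem_positions_zero {q : Position D T Act} : q ∈ positions σ τ 0 ↔ q.1 = [] := by
  simp [positions, Prod.ext_iff, eq_comm]

theorem mem_positions_succ {n : ℕ} {q : Position D T Act} :
    q ∈ positions σ τ (n + 1) ↔
      ∃ p ∈ positions σ τ n, ∃ m ∈ moves σ τ p, nextPosition σ τ p m = q := by
  simp only [positions, mem_image, mem_sigma, Sigma.exists, and_assoc, exists_and_left]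

theorem exists_isRun (q : Position D T Act) : ∃ s, s 0 = q ∧ IsRun σ τ s := by
  choose move hmove using moves_nonempty (σ := σ) (τ := τ)
  let next (p : Position D T Act) := nextPosition σ τ p (move p)
  exact ⟨fun k => next^[k] q, rfl, fun k =>
    ⟨_, hmove _, (Function.iterate_succ_apply' next k q).symm⟩⟩

theorem exists_isRun_extending {n : ℕ} {s : ℕ → Position D T Act} (hs : IsRun σ τ s)
    (hmem : s 0 ∈ positions σ τ n) :
    ∃ s', (s' 0).1 = [] ∧ IsRun σ τ s' ∧ ∀ k, s' (n + k) = s k := by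
  induction n generalizing s with
  | zero => exact ⟨s, mem_positions_zero.1 hmem, hs, fun k => by rw [zero_add]⟩
  | succ n ih =>
    obtain ⟨p, hp, hstep⟩ := mem_positions_succ.1 hmem
    let s₁ : ℕ → Position D T Act := fun k => k.casesOn p s
    have hs₁ : IsRun σ τ s₁ := fun k => k.casesOn hstep hs
    obtain ⟨s', hnil, hs', hshift⟩ := ih hs₁ hp
    exact ⟨s', hnil, hs', fun k => by rw [add_assoc, add_comm 1 k]; exact hshift (k + 1)⟩

theorem IsRun.exists_mem_playLanguage {s : ℕ → Position D T Act} (hs : IsRun σ τ s)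
    (hnil : (s 0).1 = []) :
    ∃ π ∈ playLanguage σ τ, ∀ k, (initialTurns π k, (π k).despotState) = s k := by
  choose m hm hnext using hs
  let π : ℕ → Turn D T Act := fun k => nextTurn σ τ (s k) (m k).1
  have hinit (k : ℕ) : initialTurns π k = (s k).1 := by
    induction k with
    | zero => exact hnil.symm
    | succ k ih => rw [initialTurns_succ, ih, ← hnext k]; rfl
  have hstate (k : ℕ) : (π (k + 1)).despotState = (m k).2 := congrArg Prod.snd (hnext k).symm
  refine ⟨π, ⟨fun k => ?_, fun k => ?_, fun k => ?_⟩, fun k => Prod.ext (hinit k) rfl⟩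
  · rw [hstate]
    exact mem_moves.1 (hm k)
  · rw [hinit]; rfl
  · rw [hinit]; rfl

theorem mem_positions_of_mem_playLanguage {π : ℕ → Turn D T Act} (hπ : π ∈ playLanguage σ τ)
    (n : ℕ) : (initialTurns π n, (π n).despotState) ∈ positions σ τ n := by
  obtain ⟨hplay, hσ, hτ⟩ := hπ
  induction n with
  | zero => exact mem_positions_zero.2 rfl
  | succ n ih =>
    have hturn : nextTurn σ τ (initialTurns π n, (π n).despotState) (π n).tribuneState = π n :=
      Turn.ext rfl (hσ n).symm rfl (by rw [hτ n, hσ n]; rfl)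
    refine mem_positions_succ.2 ⟨_, ih, ⟨(π n).tribuneState, (π (n + 1)).despotState⟩, ?_, ?_⟩
    · rw [mem_moves, hturn]
      exact hplay n
    · rw [nextPosition, hturn, initialTurns_succ]

theorem mem_positions_iff {n : ℕ} {q : Position D T Act} :
    q ∈ positions σ τ n ↔
      ∃ π ∈ playLanguage σ τ, (initialTurns π n, (π n).despotState) = q := by
  refine ⟨fun hq => ?_, ?_⟩
  · obtain ⟨s, rfl, hs⟩ := exists_isRun (σ := σ) (τ := τ) q
    obtain ⟨s', hnil, hs', hshift⟩ := exists_isRun_extending hs hq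
    obtain ⟨π, hπ, heq⟩ := hs'.exists_mem_playLanguage hnil
    exact ⟨π, hπ, (heq n).trans (hshift 0)⟩
  · rintro ⟨π, hπ, rfl⟩
    exact mem_positions_of_mem_playLanguage hπ n

open Classical in
theorem turnPrefixes_eq_image_positions (n : ℕ) :
    turnPrefixes (playLanguage σ τ) n = ((positions σ τ n).image Prod.fst : Finset _) := by
  ext w
  simp [turnPrefixes, mem_positions_iff]

theorem ncard_turnPrefixes_le_card_positions (n : ℕ) :
    (turnPrefixes (playLanguage σ τ) n).ncard ≤ #(positions σ τ n) := by
  classical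
  rw [turnPrefixes_eq_image_positions, Set.ncard_coe_finset]
  exact card_image_le

theorem card_positions_le_ncard_turnPrefixes_mul (n : ℕ) :
    #(positions σ τ n) ≤ (turnPrefixes (playLanguage σ τ) n).ncard * Fintype.card D := by
  classical
  rw [turnPrefixes_eq_image_positions, Set.ncard_coe_finset, ← card_univ, ← card_product]
  exact card_le_card fun q hq => mem_product.2 ⟨mem_image_of_mem _ hq, mem_univ _⟩

end Positions

section WeightedCounting

variable {D T Act : Type*} [Fintype D] [Fintype T] {A : Arena D T Act}
  {σ : DespotStrategy A} {τ : TribuneStrategy A} {u : D → ℝ} {l : ℝ}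

theorem sum_positions_zero (u : D → ℝ) : ∑ q ∈ positions σ τ 0, u q.2 = ∑ d, u d := by
  classical
  rw [positions, sum_image fun _ _ _ _ h => congrArg Prod.snd h]

theorem sum_positions_succ (u : D → ℝ) (n : ℕ) :
    ∑ q ∈ positions σ τ (n + 1), u q.2 = ∑ p ∈ positions σ τ n, ∑ m ∈ moves σ τ p, u m.2 := by
  classical
  rw [positions, sum_image (nextPosition_injective σ τ).injOn, sum_sigma]
  rfl

theorem sum_positions_le (hl : 0 ≤ l) (h : ∀ p, ∑ m ∈ moves σ τ p, u m.2 ≤ l * u p.2) (n : ℕ) :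
    ∑ q ∈ positions σ τ n, u q.2 ≤ l ^ n * ∑ d, u d := by
  induction n with
  | zero => rw [sum_positions_zero, pow_zero, one_mul]
  | succ n ih =>
    calc ∑ q ∈ positions σ τ (n + 1), u q.2
        = ∑ p ∈ positions σ τ n, ∑ m ∈ moves σ τ p, u m.2 := sum_positions_succ u n
      _ ≤ ∑ p ∈ positions σ τ n, l * u p.2 := sum_le_sum fun p _ => h p
      _ = l * ∑ p ∈ positions σ τ n, u p.2 := (mul_sum ..).symm
      _ ≤ l * (l ^ n * ∑ d, u d) := mul_le_mul_of_nonneg_left ih hl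
      _ = l ^ (n + 1) * ∑ d, u d := by ring

theorem le_sum_positions (hl : 0 ≤ l) (h : ∀ p, l * u p.2 ≤ ∑ m ∈ moves σ τ p, u m.2) (n : ℕ) :
    l ^ n * ∑ d, u d ≤ ∑ q ∈ positions σ τ n, u q.2 := by
  induction n with
  | zero => rw [sum_positions_zero, pow_zero, one_mul]
  | succ n ih =>
    calc l ^ (n + 1) * ∑ d, u d = l * (l ^ n * ∑ d, u d) := by ring
      _ ≤ l * ∑ p ∈ positions σ τ n, u p.2 := mul_le_mul_of_nonneg_left ih hl
      _ = ∑ p ∈ positions σ τ n, l * u p.2 := mul_sum ..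
      _ ≤ ∑ p ∈ positions σ τ n, ∑ m ∈ moves σ τ p, u m.2 := sum_le_sum fun p _ => h p
      _ = ∑ q ∈ positions σ τ (n + 1), u q.2 := (sum_positions_succ u n).symm

end WeightedCounting

section GrowthRate

theorem tendsto_ofReal_mul_pow_rpow {C l : ℝ} (hC : 0 < C) (hl : 0 ≤ l) :
    Tendsto (fun n : ℕ => ENNReal.ofReal (C * l ^ n) ^ (1 / (n : ℝ))) atTop
      (𝓝 (ENNReal.ofReal l)) := by
  have hroot : Tendsto (fun n : ℕ => C ^ (1 / (n : ℝ))) atTop (𝓝 1) := by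
    simpa only [Function.comp_def, Real.rpow_zero] using
      (Real.continuousAt_const_rpow hC.ne').tendsto.comp tendsto_one_div_atTop_nhds_zero_nat
  have hlim : Tendsto (fun n : ℕ => C ^ (1 / (n : ℝ)) * l) atTop (𝓝 l) := by
    simpa only [one_mul] using hroot.mul_const l
  refine (ENNReal.tendsto_ofReal hlim).congr' ?_
  filter_upwards [eventually_ne_atTop 0] with n hn
  rw [ENNReal.ofReal_rpow_of_nonneg (by positivity) (by positivity),
    Real.mul_rpow hC.le (by positivity), one_div, Real.pow_rpow_inv_natCast hl hn]

variable {a : ℕ → ℕ} {C l : ℝ}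

theorem limsup_natCast_rpow_le (hl : 0 ≤ l) (h : ∀ n, (a n : ℝ) ≤ C * l ^ n) :
    limsup (fun n => (a n : ℝ≥0∞) ^ (1 / (n : ℝ))) atTop ≤ ENNReal.ofReal l := by
  have hC : 0 < max C 1 := one_pos.trans_le (le_max_right C 1)
  refine (limsup_le_limsup (Eventually.of_forall fun n => ?_)).trans
    (tendsto_ofReal_mul_pow_rpow hC hl).limsup_eq.le
  rw [← ENNReal.ofReal_natCast]
  gcongr
  exact (h n).trans (by gcongr; exact le_max_left C 1)

theorem le_limsup_natCast_rpow (hC : 0 < C) (hl : 0 ≤ l) (h : ∀ n, C * l ^ n ≤ a n) :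
    ENNReal.ofReal l ≤ limsup (fun n => (a n : ℝ≥0∞) ^ (1 / (n : ℝ))) atTop := by
  refine (tendsto_ofReal_mul_pow_rpow hC hl).limsup_eq.ge.trans
    (limsup_le_limsup (Eventually.of_forall fun n => ?_))
  beta_reduce
  rw [← ENNReal.ofReal_natCast]
  gcongr
  exact h n

end GrowthRate

section Guarantees

variable {D T Act : Type*} {A : Arena D T Act} {σ : DespotStrategy A} {τ : TribuneStrategy A}

theorem Arena.isDeterminedWithValue_of_guarantees {V : ℝ≥0∞} (hσ : σ.Guarantees V)
    (hτ : τ.Guarantees V) : A.IsDeterminedWithValue V := by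
  have hinf : ⨅ σ : DespotStrategy A, ⨆ τ : TribuneStrategy A, payoff σ τ ≤ V :=
    iInf_le_of_le σ (iSup_le hσ)
  have hsup : V ≤ ⨆ τ : TribuneStrategy A, ⨅ σ : DespotStrategy A, payoff σ τ :=
    le_iSup_of_le τ (le_iInf hτ)
  have hweak := iSup_iInf_le_iInf_iSup fun (τ : TribuneStrategy A) (σ : DespotStrategy A) =>
    payoff σ τ
  exact ⟨hinf.antisymm (hsup.trans hweak), (hweak.trans hinf).antisymm hsup⟩

variable [Fintype D] [Fintype T] {u : D → ℝ} {l : ℝ}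

theorem payoff_le_of_sum_moves_le (hl : 0 ≤ l) (hu : ∀ d, 0 < u d)
    (h : ∀ p, ∑ m ∈ moves σ τ p, u m.2 ≤ l * u p.2) : payoff σ τ ≤ ENNReal.ofReal l := by
  obtain ⟨c, hc, hcu⟩ : ∃ c > 0, ∀ d, c < u d := by
    simpa using Pi.exists_forall_pos_add_lt hu
  refine limsup_natCast_rpow_le (C := c⁻¹ * ∑ d, u d) hl fun n => ?_
  rw [mul_assoc, ← div_eq_inv_mul, le_div_iff₀ hc]
  calc ((turnPrefixes (playLanguage σ τ) n).ncard : ℝ) * c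
      ≤ #(positions σ τ n) * c := by gcongr; exact ncard_turnPrefixes_le_card_positions n
    _ = ∑ _q ∈ positions σ τ n, c := by rw [sum_const, nsmul_eq_mul]
    _ ≤ ∑ q ∈ positions σ τ n, u q.2 := sum_le_sum fun q _ => (hcu q.2).le
    _ ≤ l ^ n * ∑ d, u d := sum_positions_le hl h n
    _ = (∑ d, u d) * l ^ n := mul_comm _ _

theorem le_payoff_of_le_sum_moves (hl : 0 ≤ l) (hu : u ∈ stdSimplex ℝ D)
    (h : ∀ p, l * u p.2 ≤ ∑ m ∈ moves σ τ p, u m.2) : ENNReal.ofReal l ≤ payoff σ τ := by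
  have hne : (univ : Finset D).Nonempty := nonempty_of_sum_ne_zero (hu.2.trans_ne one_ne_zero)
  have hcard : (0 : ℝ) < Fintype.card D := by exact_mod_cast hne.card_pos
  refine le_limsup_natCast_rpow (inv_pos.2 hcard) hl fun n => ?_
  rw [inv_mul_le_iff₀' hcard]
  calc l ^ n = l ^ n * ∑ d, u d := by rw [hu.2, mul_one]
    _ ≤ ∑ q ∈ positions σ τ n, u q.2 := le_sum_positions hl h n
    _ ≤ ∑ _q ∈ positions σ τ n, 1 := sum_le_sum fun q _ =>
        (single_le_sum (fun d _ => hu.1 d) (mem_univ q.2)).trans_eq hu.2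
    _ = #(positions σ τ n) := by rw [sum_const, nsmul_one]
    _ ≤ (turnPrefixes (playLanguage σ τ) n).ncard * Fintype.card D := by
        exact_mod_cast card_positions_le_ncard_turnPrefixes_mul n

theorem Arena.exists_positional_despot_guarantees {V : ℝ} (hV : 0 ≤ V)
    (hub : V ∈ upperBounds (collatzWielandt A.turnOperator)) :
    ∃ σ : DespotStrategy A, σ.IsPositional ∧ σ.Guarantees (ENNReal.ofReal V) := by
  obtain ⟨s, hs, hweight⟩ := Arena.exists_selection hV hub
  choose f hf hfs using fun d => exists_action_of_mem_options (hs d)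
  refine ⟨⟨fun _ => f, fun _ => hf⟩, ⟨f, fun _ _ => rfl⟩, fun τ => ?_⟩
  have hbound (l : ℝ) (hl : V < l) : payoff ⟨fun _ => f, fun _ => hf⟩ τ ≤ ENNReal.ofReal l := by
    obtain ⟨u, hu, hle⟩ := hweight l hl
    refine payoff_le_of_sum_moves_le (hV.trans hl.le) hu fun p => ?_
    rw [moves, sum_sigma, hfs]
    exact (sum_le_sum fun t _ => le_maxOption _ (τ.legal ..)).trans (hle p.2)
  exact ge_of_tendsto (ENNReal.continuous_ofReal.continuousWithinAt (s := Set.Ioi V))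
    (eventually_nhdsWithin_of_forall hbound)

theorem Arena.exists_positional_tribune_guarantees {V : ℝ}
    (hV : V ∈ collatzWielandt A.turnOperator) :
    ∃ τ : TribuneStrategy A, τ.IsPositional ∧ τ.Guarantees (ENNReal.ofReal V) := by
  obtain ⟨hV0, v, hv, hle⟩ := hV
  choose g hg hmax using exists_action_eq_maxOption A.tribune_nonblocking v
  refine ⟨⟨fun _ _ _ => g, fun _ _ _ => hg⟩, ⟨g, fun _ _ _ _ => rfl⟩, fun σ => ?_⟩
  refine le_payoff_of_le_sum_moves hV0 hv fun p => ?_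
  rw [moves, sum_sigma]
  simp only [hmax]
  exact (hle p.2).trans (minOption_le _ (σ.legal ..))

end Guarantees

theorem Arena.exists_positional_guarantees {D T Act : Type*} [Finite D] [Finite T]
    (A : Arena D T Act) : ∃ V : ℝ≥0,
      (∃ σ : DespotStrategy A, σ.IsPositional ∧ σ.Guarantees V) ∧
      ∃ τ : TribuneStrategy A, τ.IsPositional ∧ τ.Guarantees V := by
  have := Fintype.ofFinite D
  have := Fintype.ofFinite T
  rcases isEmpty_or_nonempty D with hD | hD
  · have hub : 0 ∈ upperBounds (collatzWielandt A.turnOperator) := by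
      rintro l ⟨-, x, hx, -⟩
      simpa using hx.2
    choose g hg using A.tribune_nonblocking
    exact ⟨0, by simpa using exists_positional_despot_guarantees le_rfl hub,
      ⟨fun _ _ _ => g, fun _ _ _ => hg⟩, ⟨g, fun _ _ _ _ => rfl⟩, fun _ => zero_le⟩
  · obtain ⟨V, hmem, hub⟩ :=
      exists_isGreatest_collatzWielandt A.continuous_turnOperator A.monotone_turnOperator
        A.turnOperator_smul
    exact ⟨V.toNNReal, exists_positional_despot_guarantees hmem.1 hub,
      exists_positional_tribune_guarantees hmem⟩

end EntropyGame

theorem mainTheorem3_general {D T Act : Type*} [Finite D] [Finite T]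
    (A : EntropyGame.Arena D T Act) :
    ∃ V : ℝ≥0, A.IsDeterminedWithValue (V : ℝ≥0∞) ∧
      (∃ σ : EntropyGame.DespotStrategy A, σ.IsPositional ∧ σ.Guarantees (V : ℝ≥0∞)) ∧
      (∃ τ : EntropyGame.TribuneStrategy A, τ.IsPositional ∧ τ.Guarantees (V : ℝ≥0∞)) := by
  obtain ⟨V, ⟨σ, hσ, hσV⟩, τ, hτ, hτV⟩ := A.exists_positional_guarantees
  exact ⟨V, EntropyGame.Arena.isDeterminedWithValue_of_guarantees hσV hτV,
    ⟨σ, hσ, hσV⟩, τ, hτ, hτV⟩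

/-- Every entropy game on a finite arena is determined, with a finite value, and both players have
positional optimal strategies, i.e. positional strategies guaranteeing the value. -/
theorem mainTheorem3 {D T Act : Type*} [Finite D] [Finite T] [Finite Act]
    (A : EntropyGame.Arena D T Act) :
    ∃ V : ℝ≥0, A.IsDeterminedWithValue (V : ℝ≥0∞) ∧
      (∃ σ : EntropyGame.DespotStrategy A, σ.IsPositional ∧ σ.Guarantees (V : ℝ≥0∞)) ∧
      (∃ τ : EntropyGame.TribuneStrategy A, τ.IsPositional ∧ τ.Guarantees (V : ℝ≥0∞)) :=
  mainTheorem3_general A
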